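/- Let $\mathcal G=(\mathcal V,\mathcal E,\sigma)$ be a signed directed graph with vertex set $\mathcal V=\{1,\dots,N\}$, no self-loops, at most one edge $e_{ik}$ from $i$ to $k$ for each ordered pair $(i,k)$, and signature $\sigma:\mathcal E\to\{1,-1\}$. Let $a_{ik}=\sigma(e_{ik})$ if $e_{ik}\in\mathcal E$ and $a_{ik}=0$ otherwise. Let $d>0$, $\alpha\ge 0$, $\gamma>0$, $u_1,\dots,u_N>0$, and let $S:\mathbb R\to\mathbb R$ be an odd, bounded, twice differentiable function with $S(0)=0$, $S'(0)=1$ and $\operatorname{sign}(S''(x))=-\operatorname{sign}(x)$ for all $x$. Consider the opinion dynamics on $\mathbb R^N$ $$\dot x_i=-d\,x_i+u_i\,S\Big(\alpha x_i+\gamma\sum_{k\ne i}a_{ik}x_k\Big),\qquad i=1,\dots,N.$$ For an orthant $\mathcal K=\{x\in\mathbb R^N:(-1)^{m_i}x_i\ge 0,\ i=1,\dots,N\}$ with $m_i\in\{0,1\}$, write $y\le_{\mathcal K}x$ if $x-y\in\mathcal K$. The system is type $\mathcal K$ monotone if its flow preserves $\le_{\mathcal K}$, i.e. if for any two solutions $x_1(t),x_2(t)$,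 $x_1(0)\le_{\mathcal K}x_2(0)$ implies $x_1(t)\le_{\mathcal K}x_2(t)$ for all $t>0$ (for which both solutions are defined). Switching a set $\mathcal W\subseteq\mathcal V$ replaces $\sigma$ by $\sigma_{\mathcal W}(e_{ik})=\theta(i)\sigma(e_{ik})\theta(k)$, where $\theta=-1$ on $\mathcal W$ and $\theta=1$ off $\mathcal W$; two signed graphs are switching equivalent if one is obtained from the other by switching some $\mathcal W\subseteq\mathcal V$. Then the system is type $\mathcal K$ monotone for some orthant $\mathcal K$ if and only if $\mathcal G$ is switching equivalent to the graph $\mathcal G^+$ with the same vertices and edges and with all signs equal to $1$, i.e. if and only if $\mathcal G$ is structurally balanced. -/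

import Mathlib

/-- A signed simple directed graph `(V, E, σ)`: `(i, k) ∈ edges` is the directed edge from `i` to
`k`, there are no self-loops, and `sign : E → {1, -1}` is the signature.  (`ℤˣ = {1, -1}`.) -/
structure SignedGraph (V : Type*) where
  edges : Set (V × V)
  loopless : ∀ i, (i, i) ∉ edges
  sign : edges → ℤˣ

namespace SignedGraph

variable {V : Type*}

open Classical in
/-- The switching function `θ` of a vertex set `W`: `-1` on `W` and `1` off `W`. -/
noncomputable def switchingFunction (W : Set V) (i : V) : ℤˣ :=
  if i ∈ W then -1 else 1

/-- Switching the vertex set `W`: same edges, signature `θ(i) σ(e_ik) θ(k)`. -/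
noncomputable def switch (G : SignedGraph V) (W : Set V) : SignedGraph V where
  edges := G.edges
  loopless := G.loopless
  sign e := switchingFunction W e.1.1 * G.sign e * switchingFunction W e.1.2

/-- `G` and `H` are switching equivalent: `G` can be transformed into `H` by switching. -/
def SwitchingEquivalent (G H : SignedGraph V) : Prop :=
  ∃ W : Set V, G.switch W = H

/-- The graph with the same vertices and edges, all of whose edges are positive. -/
def allPositive (G : SignedGraph V) : SignedGraph V where
  edges := G.edges
  loopless := G.loopless
  sign _ := 1

open Classical in
/-- The signed adjacency matrix. -/
noncomputable def adjMatrix (G : SignedGraph V) : Matrix V V ℝ :=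
  Matrix.of fun i k => if h : (i, k) ∈ G.edges then ((G.sign ⟨(i, k), h⟩ : ℤ) : ℝ) else 0

end SignedGraph

/-- Odd saturating functions: odd, bounded, twice differentiable, with `S 0 = 0`, `S' 0 = 1` and
`sign (S'' x) = - sign x`. -/
structure IsOddSaturation (S : ℝ → ℝ) : Prop where
  odd : ∀ x, S (-x) = -S x
  bounded : ∃ M, ∀ x, |S x| ≤ M
  differentiable : Differentiable ℝ S
  differentiable_deriv : Differentiable ℝ (deriv S)
  map_zero : S 0 = 0
  deriv_zero : deriv S 0 = 1
  sign_deriv_deriv : ∀ x, SignType.sign (deriv (deriv S) x) = -SignType.sign x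

/-- The right-hand side of the opinion dynamics
`x_i' = - d x_i + u_i S (α x_i + γ ∑_{k ≠ i} a_ik x_k)`. -/
noncomputable def opinionField {N : ℕ} (G : SignedGraph (Fin N)) (S : ℝ → ℝ) (d α γ : ℝ)
    (u : Fin N → ℝ) (x : Fin N → ℝ) : Fin N → ℝ := fun i =>
  -d * x i + u i * S (α * x i + γ * ∑ k ∈ Finset.univ.erase i, G.adjMatrix i k * x k)

/-- `x` solves the autonomous system `x' = f x` on the time interval `[0, T]`. -/
def IsSolutionOn {N : ℕ} (f : (Fin N → ℝ) → (Fin N → ℝ)) (T : ℝ) (x : ℝ → Fin N → ℝ) : Prop :=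
  ∀ t ∈ Set.Icc (0 : ℝ) T, HasDerivWithinAt x (f (x t)) (Set.Icc (0 : ℝ) T) t

/-- The orthant `{x | (-1) ^ m_i x_i ≥ 0 for all i}`, with each `m_i ∈ {0, 1}`. -/
def orthant {N : ℕ} (m : Fin N → Fin 2) : Set (Fin N → ℝ) :=
  {x | ∀ i, 0 ≤ (-1 : ℝ) ^ (m i : ℕ) * x i}

/-- The order generated by an orthant `K`: `y ≤_K x` if and only if `x - y ∈ K`. -/
def OrthantLE {N : ℕ} (m : Fin N → Fin 2) (y x : Fin N → ℝ) : Prop :=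
  x - y ∈ orthant m

/-- The system `x' = f x` on `ℝ^N` is type `K` monotone, for the orthant `K` given by `m`: its
(forward, possibly only local) flow preserves `≤_K`.  That is, any two solutions that are ordered
at time `0` stay ordered for as long as both exist. -/
def IsTypeKMonotone {N : ℕ} (m : Fin N → Fin 2) (f : (Fin N → ℝ) → (Fin N → ℝ)) : Prop :=
  ∀ (T : ℝ) (x₁ x₂ : ℝ → Fin N → ℝ), 0 < T → IsSolutionOn f T x₁ → IsSolutionOn f T x₂ →
    OrthantLE m (x₁ 0) (x₂ 0) → ∀ t ∈ Set.Ioc (0 : ℝ) T, OrthantLE m (x₁ t) (x₂ t)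

open Set Filter Topology

/-! Flipping coordinates by the signs `(-1) ^ m i` turns the order of an orthant into the standard
one and switches the graph, so balance means that some flip makes all couplings nonnegative. Since
`S` is odd and increasing, the flipped difference of two solutions is then quasipositive, and
`nonneg_of_hasDerivWithinAt_quasipositive` keeps it nonnegative. Conversely, an edge left negative
by the flip drives its tail coordinate out of the cone at time `0`: compare the zero solution with
one starting on the head's axis. -/

/-- If `f ≥ f a` to the right of `a` within `[a, b]`, its right derivative at `a` is nonnegative. -/
theorem HasDerivWithinAt.nonneg_of_right_le {f : ℝ → ℝ} {f' a b : ℝ} (hab : a < b)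
    (hf : HasDerivWithinAt f f' (Icc a b) a) (h : ∀ t ∈ Ioc a b, f a ≤ f t) : 0 ≤ f' := by
  have h1 : Tendsto (slope f a) (𝓝[Ioc a b] a) (𝓝 f') :=
    (hasDerivWithinAt_iff_tendsto_slope' (by simp)).1 (hf.mono Ioc_subset_Icc_self)
  have : (𝓝[Ioc a b] a).NeBot := by
    rw [nhdsWithin_Ioc_eq_nhdsGT hab]; infer_instance
  refine ge_of_tendsto h1 (eventually_nhdsWithin_of_forall fun t ht => ?_)
  rw [slope_def_field]
  exact div_nonneg (sub_nonneg.2 (h t ht)) (sub_nonneg.2 ht.1.le)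

/-- If `f ≥ f b` to the left of `b` within `[a, b]`, its left derivative at `b` is nonpositive. -/
theorem HasDerivWithinAt.nonpos_of_left_le {f : ℝ → ℝ} {f' a b : ℝ} (hab : a < b)
    (hf : HasDerivWithinAt f f' (Icc a b) b) (h : ∀ t ∈ Ico a b, f b ≤ f t) : f' ≤ 0 := by
  have h1 : Tendsto (slope f b) (𝓝[Ico a b] b) (𝓝 f') :=
    (hasDerivWithinAt_iff_tendsto_slope' (by simp)).1 (hf.mono Ico_subset_Icc_self)
  have : (𝓝[Ico a b] b).NeBot := by
    rw [nhdsWithin_Ico_eq_nhdsLT hab]; infer_instance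
  refine le_of_tendsto h1 (eventually_nhdsWithin_of_forall fun t ht => ?_)
  rw [slope_def_field]
  exact div_nonpos_of_nonneg_of_nonpos (sub_nonneg.2 (h t ht)) (sub_nonpos.2 ht.2.le)

/-- Invariance of the nonnegative cone: if at each point where the minimal coordinate of `z` is
`-δ < 0` that coordinate decreases at rate at most `L δ`, then `z` stays nonnegative. -/
theorem nonneg_of_hasDerivWithinAt_quasipositive {ι : Type*} [Finite ι] {T L : ℝ}
    {z z' : ℝ → ι → ℝ}
    (hz : ∀ i, ∀ t ∈ Icc 0 T, HasDerivWithinAt (fun s => z s i) (z' t i) (Icc 0 T) t)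
    (hL : ∀ t ∈ Icc 0 T, ∀ i, ∀ δ > 0, (∀ k, -δ ≤ z t k) → z t i = -δ → -(L * δ) ≤ z' t i)
    (h0 : ∀ i, 0 ≤ z 0 i) : ∀ t ∈ Icc 0 T, ∀ i, 0 ≤ z t i := by
  -- The barrier grows at rate `L + 1`. At the first time a coordinate meets it, with `δ = ε * exp
  -- ((L + 1) * τ)`, the perturbed coordinate has derivative at least `-L * δ + (L + 1) * δ = δ >
  -- 0`, yet it has come down to zero from positive values.
  have key : ∀ ε > 0, ∀ t ∈ Icc 0 T, ∀ i, 0 < z t i + ε * Real.exp ((L + 1) * t) := by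
    intro ε hε
    have hv : ∀ i, ∀ t ∈ Icc 0 T, HasDerivWithinAt (fun s => z s i + ε * Real.exp ((L + 1) * s))
        (z' t i + ε * (Real.exp ((L + 1) * t) * ((L + 1) * 1))) (Icc 0 T) t := fun i t ht =>
      (hz i t ht).add ((((hasDerivAt_id t).const_mul (L + 1)).exp.const_mul ε).hasDerivWithinAt)
    have hc : ∀ i, ContinuousOn (fun s => z s i + ε * Real.exp ((L + 1) * s)) (Icc 0 T) :=
      fun i t ht => (hv i t ht).continuousWithinAt
    by_contra! hne
    obtain ⟨t₁, ht₁, i₁, hi₁⟩ := hne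
    let B : Set ℝ := ⋃ i, Icc 0 T ∩ (fun s => z s i + ε * Real.exp ((L + 1) * s)) ⁻¹' Iic 0
    have hB : IsCompact B := by
      refine isCompact_iUnion fun i => ?_
      exact isCompact_Icc.of_isClosed_subset
        ((hc i).preimage_isClosed_of_isClosed isClosed_Icc isClosed_Iic) inter_subset_left
    obtain ⟨τ, hτB, hτ⟩ := hB.exists_isLeast ⟨t₁, mem_iUnion.2 ⟨i₁, ht₁, hi₁⟩⟩
    obtain ⟨i, hτI, hi⟩ := mem_iUnion.1 hτB
    have hi : z τ i + ε * Real.exp ((L + 1) * τ) ≤ 0 := hi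
    have hpre : ∀ t ∈ Ico 0 τ, ∀ k, 0 < z t k + ε * Real.exp ((L + 1) * t) := by
      intro t ht k
      by_contra! hle
      exact absurd (hτ (mem_iUnion.2 ⟨k, ⟨ht.1, ht.2.le.trans hτI.2⟩, hle⟩)) (not_le.2 ht.2)
    have hτ0 : 0 < τ := by
      rcases hτI.1.eq_or_lt with h | h
      · subst h
        have := h0 i
        simp only [mul_zero, Real.exp_zero, mul_one] at hi
        linarith
      · exact h
    have hall : ∀ k, 0 ≤ z τ k + ε * Real.exp ((L + 1) * τ) := by
      intro k
      have : (𝓝[Ico 0 τ] τ).NeBot := by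
        rw [nhdsWithin_Ico_eq_nhdsLT hτ0]; infer_instance
      refine ge_of_tendsto (((hc k) τ hτI).mono
        (fun t ht => ⟨ht.1, ht.2.le.trans hτI.2⟩ : Ico 0 τ ⊆ Icc 0 T)).tendsto
        (eventually_nhdsWithin_of_forall fun t ht => (hpre t ht k).le)
    have hpos : 0 < ε * Real.exp ((L + 1) * τ) := by positivity
    have h1 := hL τ hτI i _ hpos (fun k => by linarith [hall k]) (by linarith [hall i])
    have h2 := ((hv i τ hτI).mono (Icc_subset_Icc_right hτI.2)).nonpos_of_left_le hτ0
      fun t ht => hi.trans (hpre t ht i).le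
    nlinarith
  intro t ht i
  refine le_of_forall_pos_le_add fun η hη => ?_
  have := key (η / Real.exp ((L + 1) * t)) (by positivity) t ht i
  rw [div_mul_cancel₀ _ (Real.exp_ne_zero _)] at this
  exact this.le

/-! ### Monotonicity and Lipschitz bounds for the saturation -/

namespace IsOddSaturation

variable {S : ℝ → ℝ}

theorem deriv_neg (hS : IsOddSaturation S) (x : ℝ) : deriv S (-x) = deriv S x := by
  have h : (fun y => S (-y)) = fun y => -S y := funext hS.odd
  have h1 := congrFun (congrArg deriv h) x
  rw [deriv_comp_neg, deriv.fun_neg] at h1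
  linarith

theorem strictAntiOn_deriv (hS : IsOddSaturation S) : StrictAntiOn (deriv S) (Ici 0) := by
  refine strictAntiOn_of_deriv_neg (convex_Ici 0) hS.differentiable_deriv.continuous.continuousOn
    fun x hx => ?_
  rw [interior_Ici, mem_Ioi] at hx
  have := hS.sign_deriv_deriv x
  rw [sign_pos hx] at this
  exact sign_eq_neg_one_iff.1 this

/-- Otherwise strict decrease of `S'` makes it negative at `x + 1` and no larger beyond, so `S`
falls below a line of negative slope, against boundedness. -/
theorem deriv_pos_of_nonneg (hS : IsOddSaturation S) {x : ℝ} (hx : 0 ≤ x) : 0 < deriv S x := by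
  by_contra! hle
  obtain ⟨M, hM⟩ := hS.bounded
  have hc : deriv S (x + 1) < 0 :=
    (hS.strictAntiOn_deriv hx (by simp; linarith) (by linarith)).trans_le hle
  have hlin : ∀ y, x + 1 ≤ y → S y - S (x + 1) ≤ deriv S (x + 1) * (y - (x + 1)) := fun y hy =>
    (convex_Ici (x + 1)).image_sub_le_mul_sub_of_deriv_le hS.differentiable.continuous.continuousOn
      hS.differentiable.differentiableOn
      (fun w hw => by
        rw [interior_Ici, mem_Ioi] at hw
        exact hS.strictAntiOn_deriv.antitoneOn (by simp; linarith) (by simp; linarith) hw.le)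
      _ (by simp) _ hy hy
  have hM0 : 0 ≤ M := (abs_nonneg _).trans (hM 0)
  -- Over this distance `S` drops by at least `2 * M + 1`, more than the `2 * M` that the bound
  -- allows.
  have h := hlin (x + 1 + (2 * M + 1) / -deriv S (x + 1)) (by
    have : 0 ≤ (2 * M + 1) / -deriv S (x + 1) := div_nonneg (by linarith) (by linarith)
    linarith)
  have h2 : deriv S (x + 1) * ((2 * M + 1) / -deriv S (x + 1)) = -(2 * M + 1) := by
    have := hc.ne
    field_simp
  rw [add_sub_cancel_left, h2] at h
  linarith [(abs_le.1 (hM (x + 1 + (2 * M + 1) / -deriv S (x + 1)))).1,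
    (abs_le.1 (hM (x + 1))).2]

theorem deriv_abs (hS : IsOddSaturation S) (x : ℝ) : deriv S |x| = deriv S x := by
  rcases abs_choice x with h | h <;> rw [h]
  exact hS.deriv_neg x

theorem deriv_pos (hS : IsOddSaturation S) (x : ℝ) : 0 < deriv S x :=
  hS.deriv_abs x ▸ hS.deriv_pos_of_nonneg (abs_nonneg x)

theorem deriv_le_one (hS : IsOddSaturation S) (x : ℝ) : deriv S x ≤ 1 := by
  rw [← hS.deriv_abs x, ← hS.deriv_zero]
  exact hS.strictAntiOn_deriv.antitoneOn (by simp) (abs_nonneg x) (abs_nonneg x)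

theorem strictMono (hS : IsOddSaturation S) : StrictMono S := strictMono_of_deriv_pos hS.deriv_pos

theorem contDiff (hS : IsOddSaturation S) : ContDiff ℝ 1 S :=
  contDiff_one_iff_deriv.2 ⟨hS.differentiable, hS.differentiable_deriv.continuous⟩

/-- Follows from `0 < S' ≤ 1`; it bounds how fast a minimal coordinate can decrease. -/
theorem neg_le_sub (hS : IsOddSaturation S) {p q c : ℝ} (hc : 0 ≤ c) (h : -c ≤ q - p) :
    -c ≤ S q - S p := by
  rcases le_total p q with hpq | hpq
  · linarith [hS.strictMono.monotone hpq]
  · have := (convex_univ).image_sub_le_mul_sub_of_deriv_le (C := 1)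
      hS.differentiable.continuous.continuousOn hS.differentiable.differentiableOn
      (fun x _ => hS.deriv_le_one x) q (mem_univ _) p (mem_univ _) hpq
    linarith

end IsOddSaturation

/-! ### Structural balance and orthants -/

namespace SignedGraph

theorem switch_eq_allPositive_iff {V : Type*} {G : SignedGraph V} {W : Set V} :
    G.switch W = G.allPositive ↔
      ∀ e : G.edges, switchingFunction W e.1.1 * G.sign e * switchingFunction W e.1.2 = 1 := by
  simp only [switch, allPositive, mk.injEq, heq_eq_eq, true_and, funext_iff]

variable {N : ℕ} {G : SignedGraph (Fin N)}

theorem coe_switchingFunction_orthant (m : Fin N → Fin 2) (i : Fin N) :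
    ((switchingFunction {j | m j = 1} i : ℤ) : ℝ) = (-1) ^ (m i : ℕ) := by
  have h : m i = 0 ∨ m i = 1 := by omega
  rcases h with h | h <;> simp [switchingFunction, h]

theorem exists_orthant_of_set (W : Set (Fin N)) : ∃ m : Fin N → Fin 2, {j | m j = 1} = W := by
  classical
  exact ⟨fun j => if j ∈ W then 1 else 0, by ext j; by_cases h : j ∈ W <;> simp [h]⟩

/-- Balance, in terms of the signs defining an orthant. -/
theorem switchingEquivalent_allPositive_iff :
    G.SwitchingEquivalent G.allPositive ↔ ∃ m : Fin N → Fin 2, ∀ i k, (i, k) ∈ G.edges →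
      (-1 : ℝ) ^ (m i : ℕ) * G.adjMatrix i k * (-1) ^ (m k : ℕ) = 1 := by
  have key : ∀ m : Fin N → Fin 2, G.switch {j | m j = 1} = G.allPositive ↔
      ∀ i k, (i, k) ∈ G.edges →
        (-1 : ℝ) ^ (m i : ℕ) * G.adjMatrix i k * (-1) ^ (m k : ℕ) = 1 := by
    intro m
    rw [switch_eq_allPositive_iff]
    simp only [Subtype.forall, Prod.forall]
    refine forall₃_congr fun i k h => ?_
    rw [← coe_switchingFunction_orthant, ← coe_switchingFunction_orthant]
    simp only [adjMatrix, Matrix.of_apply, dif_pos h, ← Units.val_inj]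
    norm_cast
    simp only [Units.val_eq_one]
  constructor
  · rintro ⟨W, hW⟩
    obtain ⟨m, rfl⟩ := exists_orthant_of_set W
    exact ⟨m, (key m).1 hW⟩
  · rintro ⟨m, hm⟩
    exact ⟨_, (key m).2 hm⟩

theorem adjMatrix_of_notMem {i k : Fin N} (h : (i, k) ∉ G.edges) : G.adjMatrix i k = 0 := by
  simp [adjMatrix, h]

theorem adjMatrix_eq_one_or_neg_one {i k : Fin N} (h : (i, k) ∈ G.edges) :
    G.adjMatrix i k = 1 ∨ G.adjMatrix i k = -1 := by
  simp only [adjMatrix, Matrix.of_apply, dif_pos h]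
  rcases Int.units_eq_one_or (G.sign ⟨(i, k), h⟩) with h | h <;> simp [h]

end SignedGraph

/-! ### Monotonicity of the opinion dynamics -/

section Dynamics

variable {N : ℕ} {G : SignedGraph (Fin N)} {S : ℝ → ℝ} {d α γ : ℝ} {u : Fin N → ℝ}

theorem IsOddSaturation.map_sign_mul (hS : IsOddSaturation S) (n : ℕ) (x : ℝ) :
    S ((-1) ^ n * x) = (-1) ^ n * S x := by
  rcases neg_one_pow_eq_or ℝ n with h | h <;> simp [h, hS.odd]

theorem opinionField_zero (hS : IsOddSaturation S) : opinionField G S d α γ u 0 = 0 := by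
  ext i; simp [opinionField, hS.map_zero]

theorem contDiff_opinionField (hS : IsOddSaturation S) :
    ContDiff ℝ 1 (opinionField G S d α γ u) := by
  have := hS.contDiff
  unfold opinionField
  fun_prop

theorem exists_isSolutionOn (hS : IsOddSaturation S) (x₀ : Fin N → ℝ) :
    ∃ T > 0, ∃ x, x 0 = x₀ ∧ IsSolutionOn (opinionField G S d α γ u) T x := by
  obtain ⟨x, hx0, ε, hε, hx⟩ :=
    (contDiff_opinionField (G := G) (d := d) (α := α) (γ := γ) (u := u)
      hS).contDiffAt.exists_forall_mem_closedBall_exists_eq_forall_mem_Ioo_hasDerivAt₀ (x₀ := x₀) 0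
  refine ⟨ε / 2, by positivity, x, hx0, fun t ht => (hx t ⟨?_, ?_⟩).hasDerivWithinAt⟩ <;>
    linarith [ht.1, ht.2]

theorem isTypeKMonotone_of_balanced (hS : IsOddSaturation S) (hα : 0 ≤ α) (hγ : 0 < γ)
    (hd : 0 < d) (hu : ∀ i, 0 < u i) {m : Fin N → Fin 2}
    (hm : ∀ i k, (i, k) ∈ G.edges →
      (-1 : ℝ) ^ (m i : ℕ) * G.adjMatrix i k * (-1) ^ (m k : ℕ) = 1) :
    IsTypeKMonotone m (opinionField G S d α γ u) := by
  intro T x₁ x₂ hT h₁ h₂ h0 t ht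
  have hsq : ∀ k, (-1 : ℝ) ^ (m k : ℕ) * (-1) ^ (m k : ℕ) = 1 := fun k => by
    rw [← mul_pow]; simp
  -- The switched adjacency matrix, nonnegative by balance.
  let b : Fin N → Fin N → ℝ := fun i k => (-1 : ℝ) ^ (m i : ℕ) * G.adjMatrix i k * (-1) ^ (m k : ℕ)
  have hb : ∀ i k, 0 ≤ b i k := by
    intro i k
    by_cases h : (i, k) ∈ G.edges
    · exact zero_le_one.trans_eq (hm i k h).symm
    · simp [b, SignedGraph.adjMatrix_of_notMem h]
  let C : Fin N → ℝ := fun i => α + γ * ∑ k ∈ Finset.univ.erase i, b i k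
  have hC : ∀ i, 0 ≤ C i := fun i =>
    add_nonneg hα (mul_nonneg hγ.le (Finset.sum_nonneg fun k _ => hb i k))
  let p : (Fin N → ℝ) → Fin N → ℝ := fun x i =>
    α * x i + γ * ∑ k ∈ Finset.univ.erase i, G.adjMatrix i k * x k
  let z : ℝ → Fin N → ℝ := fun s i => (-1 : ℝ) ^ (m i : ℕ) * (x₂ s i - x₁ s i)
  have hp : ∀ s i, (-1 : ℝ) ^ (m i : ℕ) * p (x₂ s) i - (-1 : ℝ) ^ (m i : ℕ) * p (x₁ s) i =
      α * z s i + γ * ∑ k ∈ Finset.univ.erase i, b i k * z s k := by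
    intro s i
    have : ∀ k, b i k * z s k =
        (-1 : ℝ) ^ (m i : ℕ) * (G.adjMatrix i k * x₂ s k - G.adjMatrix i k * x₁ s k) := by
      intro k
      linear_combination ((-1 : ℝ) ^ (m i : ℕ) * G.adjMatrix i k * (x₂ s k - x₁ s k)) * hsq k
    simp only [this, ← Finset.mul_sum, Finset.sum_sub_distrib, p, z]
    ring
  refine nonneg_of_hasDerivWithinAt_quasipositive (z := z) (L := ∑ i, u i * C i)
    (z' := fun s i => (-1 : ℝ) ^ (m i : ℕ) *
      (opinionField G S d α γ u (x₂ s) i - opinionField G S d α γ u (x₁ s) i))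
    (fun i s hs => ?_) (fun s hs i δ hδ hk hi => ?_) h0 t (Ioc_subset_Icc_self ht)
  · exact ((hasDerivWithinAt_pi.1 (h₂ s hs) i).sub
      (hasDerivWithinAt_pi.1 (h₁ s hs) i)).const_mul _
  · have hq : -(C i * δ) ≤
        (-1 : ℝ) ^ (m i : ℕ) * p (x₂ s) i - (-1 : ℝ) ^ (m i : ℕ) * p (x₁ s) i := by
      rw [hp, hi]
      have : (∑ k ∈ Finset.univ.erase i, b i k) * -δ ≤
          ∑ k ∈ Finset.univ.erase i, b i k * z s k := by
        rw [Finset.sum_mul]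
        exact Finset.sum_le_sum fun k _ => mul_le_mul_of_nonneg_left (hk k) (hb i k)
      have := mul_le_mul_of_nonneg_left this hγ.le
      simp only [C]
      linarith
    have hs := hS.neg_le_sub (mul_nonneg (hC i) hδ.le) hq
    rw [hS.map_sign_mul, hS.map_sign_mul] at hs
    have hs := mul_le_mul_of_nonneg_left hs (hu i).le
    have hL : u i * C i ≤ ∑ i, u i * C i :=
      Finset.single_le_sum (f := fun i => u i * C i)
        (fun j _ => mul_nonneg (hu j).le (hC j)) (Finset.mem_univ i)
    have hL := mul_le_mul_of_nonneg_right hL hδ.le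
    have hz : (-1 : ℝ) ^ (m i : ℕ) *
        (opinionField G S d α γ u (x₂ s) i - opinionField G S d α γ u (x₁ s) i) =
        -d * z s i + u i * ((-1) ^ (m i : ℕ) * S (p (x₂ s) i) -
          (-1) ^ (m i : ℕ) * S (p (x₁ s) i)) := by
      simp only [opinionField, z, p]; ring
    -- At `z s i = -δ` the decay term contributes `d * δ > 0`, so it only helps.
    have hdδ := mul_pos hd hδ
    rw [hz, hi]
    linarith

theorem balanced_of_isTypeKMonotone (hS : IsOddSaturation S) (hγ : 0 < γ) (hu : ∀ i, 0 < u i)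
    {m : Fin N → Fin 2} (hm : IsTypeKMonotone m (opinionField G S d α γ u))
    (i k : Fin N) (hik : (i, k) ∈ G.edges) :
    (-1 : ℝ) ^ (m i : ℕ) * G.adjMatrix i k * (-1) ^ (m k : ℕ) = 1 := by
  have hne : i ≠ k := by rintro rfl; exact G.loopless i hik
  by_contra hcon
  have hneg : (-1 : ℝ) ^ (m i : ℕ) * (G.adjMatrix i k * (-1) ^ (m k : ℕ)) = -1 := by
    rcases neg_one_pow_eq_or ℝ (m i : ℕ) with h | h <;>
    rcases neg_one_pow_eq_or ℝ (m k : ℕ) with h' | h' <;>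
    rcases SignedGraph.adjMatrix_eq_one_or_neg_one hik with h'' | h'' <;>
    simp_all
  -- The initial point lies in the cone on the axis of `k`, so coordinate `i` starts at zero and
  -- feels only the edge to `k`.
  obtain ⟨T, hT, x, hx0, hx⟩ := exists_isSolutionOn (G := G) (d := d) (α := α) (γ := γ) (u := u)
    hS (Pi.single k ((-1) ^ (m k : ℕ)))
  have hzero : IsSolutionOn (opinionField G S d α γ u) T (fun _ => 0) := fun t _ => by
    rw [opinionField_zero hS]; exact hasDerivWithinAt_const ..
  have hmono := hm T _ x hT hzero hx (fun j => by
    rw [hx0]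
    rcases eq_or_ne j k with rfl | hj
    · simp [← mul_pow]
    · simp [hj])
  have hder := (hasDerivWithinAt_pi.1 (hx 0 ⟨le_rfl, hT.le⟩) i).const_mul ((-1 : ℝ) ^ (m i : ℕ))
  have h := hder.nonneg_of_right_le hT fun t ht => by
    simpa [hx0, hne] using hmono t ht i
  have hsum : ∑ j ∈ Finset.univ.erase i, G.adjMatrix i j *
      (Pi.single k ((-1) ^ (m k : ℕ)) : Fin N → ℝ) j = G.adjMatrix i k * (-1) ^ (m k : ℕ) := by
    rw [Finset.sum_eq_single_of_mem k (by simp [hne.symm]) (fun j _ hj => by simp [hj])]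
    simp
  have hval : (-1 : ℝ) ^ (m i : ℕ) * opinionField G S d α γ u (x 0) i = u i * S (-γ) := by
    have hγ' : -γ = (-1 : ℝ) ^ (m i : ℕ) * (γ * (G.adjMatrix i k * (-1) ^ (m k : ℕ))) := by
      linear_combination (-γ) * hneg
    rw [hγ', hS.map_sign_mul, hx0]
    simp only [opinionField, hsum, Pi.single_eq_of_ne hne, mul_zero, zero_add]
    ring
  rw [hval] at h
  have : S (-γ) < 0 := hS.map_zero ▸ hS.strictMono (neg_lt_zero.2 hγ)
  exact absurd h (not_le.2 (mul_neg_of_pos_of_neg (hu i) this))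

end Dynamics

theorem mainTheorem6 {N : ℕ} (G : SignedGraph (Fin N)) (S : ℝ → ℝ) (hS : IsOddSaturation S)
    (d α γ : ℝ) (hd : 0 < d) (hα : 0 ≤ α) (hγ : 0 < γ) (u : Fin N → ℝ) (hu : ∀ i, 0 < u i) :
    (∃ m : Fin N → Fin 2, IsTypeKMonotone m (opinionField G S d α γ u)) ↔
      G.SwitchingEquivalent G.allPositive := by
  rw [SignedGraph.switchingEquivalent_allPositive_iff]
  exact exists_congr fun m => ⟨fun h => balanced_of_isTypeKMonotone hS hγ hu h,
    fun h => isTypeKMonotone_of_balanced hS hα hγ hd hu h⟩
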